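/- Let $\chi$ be a second countable Hausdorff space (for example a Polish space, or a locally compact second countable Hausdorff space) with its Borel $\sigma$-algebra, and let $\mu$ be a finite Borel measure on $\chi$. Let $\mathfrak R^f$ be the set of finite point configurations $X$ in $\chi$ (points counted with multiplicity), with the $\sigma$-algebra generated by the maps $X\mapsto N(X_B)$, $B\subseteq\chi$ Borel, where $N(X_B)$ is the number of points of $X$ in $B$ and $N(X)=N(X_\chi)$. Let $\pi$ be the law on $\mathfrak R^f$ of the Poisson process of unit rate with respect to $\mu$ (that is, with intensity measure $\mu$): $\pi(A)=\sum_{n\ge 0}\frac{e^{-\mu(\chi)}}{n!}\int_{\chi^n}\mathbf 1[\{x_1,\dots,x_n\}\in A]\,\mu(dx_1)\cdots\mu(dx_n)$. Let $\nu_1,\nu_2$ be finite Borel measures on $\chi$ that are regular in the sense that $\nu_j(B)=\inf\{\nu_j(G): G\supseteq B \text{ open}\}$ for every Borel set $B$. Let $Z_1,Z_2$ be maps from $\chi$ to the set $\mathcal K$ of compact subsets of $\chi$ that are continuous for the myopic topology on $\mathcal K$ (the topology generated by the sets $\{K: K\cap F=\emptyset\}$, $F$ closed, and $\{K: K\cap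 G\neq\emptyset\}$, $G$ open), and put $U_j(X)=\bigcup_{x\in X}Z_j(x)$. Let $\lambda>0$, $\gamma_1\in[1,\infty)$, $\gamma_2\in(0,1]$. Then for every constant $\alpha>0$ (in particular for the normalising constant) the density of the generalised multiscale area-interaction process, $$p(X)=\alpha\,\lambda^{N(X)}\,\gamma_1^{-\nu_1(U_1(X))}\,\gamma_2^{-\nu_2(U_2(X))},\qquad X\in\mathfrak R^f,$$ is a measurable function on $\mathfrak R^f$ and is integrable with respect to $\pi$. -/

import Mathlib

open MeasureTheory TopologicalSpace

namespace AreaInteraction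

/-- Finite point configurations in `χ`, points being counted with multiplicity. -/
abbrev Configuration (χ : Type*) := Multiset χ

open Classical in
/-- `N(X_B)`: the number of points of the configuration `X` that lie in `B`. -/
noncomputable def pointCount {χ : Type*} (B : Set χ) (X : Configuration χ) : ℕ :=
  X.countP (fun x => x ∈ B)

/-- The usual σ-algebra on finite configurations: the smallest one for which all the counts
`X ↦ N(X_B)`, `B` measurable, are measurable. -/
noncomputable instance configurationMeasurableSpace {χ : Type*} [MeasurableSpace χ] :
    MeasurableSpace (Configuration χ) :=
  ⨆ B : {B : Set χ // MeasurableSet B}, MeasurableSpace.comap (pointCount B.1) ⊤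

/-- The configuration `{x_1, …, x_n}` of an `n`-tuple of points. -/
def ofTuple {χ : Type*} (n : ℕ) (x : Fin n → χ) : Configuration χ :=
  (Finset.univ : Finset (Fin n)).val.map x

theorem measurable_pointCount {χ : Type*} [MeasurableSpace χ] {B : Set χ} (hB : MeasurableSet B) :
    Measurable (pointCount B : Configuration χ → ℕ) :=
  Measurable.of_comap_le
    (le_iSup (fun B : {B : Set χ // MeasurableSet B} =>
      MeasurableSpace.comap (pointCount B.1) ⊤) ⟨B, hB⟩)

theorem measurable_ofTuple {χ : Type*} [MeasurableSpace χ] (n : ℕ) :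
    Measurable (ofTuple n : (Fin n → χ) → Configuration χ) := by
  classical
  refine Measurable.of_le_map (iSup_le fun B => ?_)
  rw [MeasurableSpace.comap_le_iff_le_map, MeasurableSpace.map_comp]
  suffices h : Measurable (pointCount B.1 ∘ ofTuple (χ := χ) n) from h.le_map
  have : (pointCount B.1 ∘ ofTuple (χ := χ) n)
      = fun x => ∑ i : Fin n, if x i ∈ B.1 then 1 else 0 := by
    funext x
    simp only [pointCount, ofTuple, Function.comp_apply, Finset.sum_boole, Nat.cast_id]
    rw [Multiset.countP_map, Finset.card_def, Finset.filter_val]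
  rw [this]
  exact Finset.measurable_sum _ fun i _ =>
    Measurable.ite (measurable_pi_apply i B.2) measurable_const measurable_const

/-- The law of the Poisson process on `χ` that has unit rate with respect to the finite measure `μ`,
i.e. with intensity measure `μ`:
`P(A) = ∑ₙ (e^{-μ(χ)} / n!) ∫ ⋯ ∫ 1[{x_1, …, x_n} ∈ A] μ(dx_1) ⋯ μ(dx_n)`. -/
noncomputable def poissonLaw {χ : Type*} [MeasurableSpace χ] (μ : Measure χ) [IsFiniteMeasure μ] :
    Measure (Configuration χ) :=
  Measure.sum fun n : ℕ =>
    ENNReal.ofReal (Real.exp (-μ.real Set.univ) / n.factorial) •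
      (Measure.pi fun _ : Fin n => μ).map (ofTuple n)

instance {χ : Type*} [MeasurableSpace χ] (μ : Measure χ) [IsFiniteMeasure μ] :
    IsProbabilityMeasure (poissonLaw μ) := by
  have hr : ∀ n : ℕ, ENNReal.ofReal (Real.exp (-μ.real Set.univ) / n.factorial) *
      (μ Set.univ) ^ n
        = ENNReal.ofReal (Real.exp (-μ.real Set.univ) *
            (μ.real Set.univ ^ n / n.factorial)) := by
    intro n
    rw [← ofReal_measureReal (μ := μ) (s := Set.univ), ← ENNReal.ofReal_pow measureReal_nonneg,
      ← ENNReal.ofReal_mul (by positivity)]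
    congr 1
    ring
  have hs : HasSum (fun n : ℕ => Real.exp (-μ.real Set.univ) *
      (μ.real Set.univ ^ n / n.factorial)) 1 := by
    have := (NormedSpace.expSeries_div_hasSum_exp (μ.real Set.univ)).mul_left
      (Real.exp (-μ.real Set.univ))
    rwa [← Real.exp_eq_exp_ℝ, ← Real.exp_add, neg_add_cancel, Real.exp_zero] at this
  constructor
  rw [poissonLaw, Measure.sum_apply _ MeasurableSet.univ]
  simp_rw [Measure.smul_apply, Measure.map_apply (measurable_ofTuple _) MeasurableSet.univ,
    Set.preimage_univ, Measure.pi_univ, Finset.prod_const, Finset.card_univ, Fintype.card_fin,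
    smul_eq_mul, hr]
  rw [← ENNReal.ofReal_tsum_of_nonneg (fun n => by positivity) hs.summable, hs.tsum_eq,
    ENNReal.ofReal_one]

/-- `U(X) = ⋃_{x ∈ X} Z(x)`. -/
def grainUnion {χ : Type*} [TopologicalSpace χ] (Z : χ → Compacts χ) (X : Configuration χ) :
    Set χ :=
  ⋃ x ∈ X, (Z x : Set χ)

/-- A compact-set-valued map is myopically continuous if it is continuous for the myopic topology,
which is generated by the sets `{K | K ∩ F = ∅}`, `F` closed, and `{K | K ∩ G ≠ ∅}`, `G` open. This
is the topology that `Compacts χ` carries in Mathlib, under the name of Vietoris topology. -/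
def MyopicallyContinuous {χ : Type*} [TopologicalSpace χ] (Z : χ → Compacts χ) : Prop :=
  Continuous Z

/-- The function
`p(X) = α λ^{N(X)} γ₁^{-ν₁(U₁(X))} γ₂^{-ν₂(U₂(X))}`. -/
noncomputable def multiscaleDensity {χ : Type*} [TopologicalSpace χ] [MeasurableSpace χ]
    (α lam γ₁ γ₂ : ℝ) (ν₁ ν₂ : Measure χ) (Z₁ Z₂ : χ → Compacts χ) (X : Configuration χ) : ℝ :=
  α * lam ^ X.card * γ₁ ^ (-ν₁.real (grainUnion Z₁ X)) * γ₂ ^ (-ν₂.real (grainUnion Z₂ X))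

end AreaInteraction

/-! The normalising factors of the density are powers of measurable functions of the configuration,
so measurability reduces to that of `X ↦ ν (U(X))`. As `ν` is outer regular and `U(X)` is compact,
`ν (U(X)) < t` holds exactly when `U(X)` is contained in a set `G` with `ν G < t` that is a finite
union of members of a fixed countable basis. There are countably many such `G`, and for each of them
`U(X) ⊆ G` says that `X` has no point outside `{x | Z x ⊆ G}`, a set that is open because `Z` is
continuous; so `U(X) ⊆ G` is an event about a point count
(`AreaInteraction.measurable_measure_grainUnion`).

For integrability, `γ₁ ≥ 1` makes the first interaction factor at most `1`, and `γ₂ ≤ 1` with `ν₂`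
finite bounds the second by the constant `γ₂ ^ (-ν₂(χ))`. Hence the density is dominated by a
multiple of `λ ^ N(X)`, whose Poisson integral is an exponential series
(`AreaInteraction.integrable_pow_card`). -/

namespace AreaInteraction

theorem measurable_card {χ : Type*} [MeasurableSpace χ] :
    Measurable (Multiset.card : Configuration χ → ℕ) := by
  have h : (Multiset.card : Configuration χ → ℕ) = pointCount Set.univ := by
    funext X
    simp [pointCount]
  rw [h]
  exact measurable_pointCount MeasurableSet.univ

theorem isCompact_grainUnion {χ : Type*} [TopologicalSpace χ] (Z : χ → Compacts χ)
    (X : Configuration χ) : IsCompact (grainUnion Z X) := by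
  classical
  have h : grainUnion Z X = ⋃ x ∈ X.toFinset, (Z x : Set χ) := by
    simp [grainUnion]
  rw [h]
  exact X.toFinset.isCompact_biUnion fun x _ => (Z x).isCompact

/-- The configurations whose grains all lie in an open set form an event: they have no points in the
closed set of those `x` for which `Z x` is not contained in it. -/
theorem measurableSet_grainUnion_subset {χ : Type*} [TopologicalSpace χ] [MeasurableSpace χ]
    [OpensMeasurableSpace χ] {Z : χ → Compacts χ} (hZ : MyopicallyContinuous Z) {G : Set χ}
    (hG : IsOpen G) : MeasurableSet {X : Configuration χ | grainUnion Z X ⊆ G} := by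
  have hopen : IsOpen {x | (Z x : Set χ) ⊆ G} :=
    (Compacts.isOpen_subsets_of_isOpen hG).preimage hZ
  have h : {X : Configuration χ | grainUnion Z X ⊆ G}
      = pointCount {x | (Z x : Set χ) ⊆ G}ᶜ ⁻¹' {0} := by
    ext X
    simp [grainUnion, pointCount, Multiset.countP_eq_zero]
  rw [h]
  exact measurable_pointCount hopen.measurableSet.compl (measurableSet_singleton 0)

/-- The measure of the union of the grains is a measurable function of the configuration. -/
theorem measurable_measure_grainUnion {χ : Type*} [TopologicalSpace χ]
    [SecondCountableTopology χ] [MeasurableSpace χ] [OpensMeasurableSpace χ]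
    (ν : Measure χ) [ν.OuterRegular] {Z : χ → Compacts χ} (hZ : MyopicallyContinuous Z) :
    Measurable fun X : Configuration χ => ν (grainUnion Z X) := by
  refine measurable_of_Iio fun t => ?_
  let 𝒢 : Set (Set (Set χ)) := {s | s.Finite ∧ s ⊆ countableBasis χ} ∩ {s | ν (⋃₀ s) < t}
  have hcount : 𝒢.Countable :=
    (Set.countable_ofPred_finite_subset (countable_countableBasis χ)).mono Set.inter_subset_left
  have h : (fun X : Configuration χ => ν (grainUnion Z X)) ⁻¹' Set.Iio t
      = ⋃ s ∈ 𝒢, {X | grainUnion Z X ⊆ ⋃₀ s} := by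
    ext X
    simp only [Set.mem_preimage, Set.mem_Iio, Set.mem_iUnion, Set.mem_ofPred_eq, exists_prop]
    constructor
    · intro hX
      obtain ⟨G, hXG, hG, hGt⟩ := (grainUnion Z X).exists_isOpen_lt_of_lt t hX
      -- A basic neighbourhood inside `G` around each point of the compact set.
      obtain ⟨s, hs, hsf, hXs⟩ := (isCompact_grainUnion Z X).elim_finite_subcover_image
        (b := {u ∈ countableBasis χ | u ⊆ G}) (c := id)
        (fun u hu => isOpen_of_mem_countableBasis hu.1)
        (fun x hx => by
          obtain ⟨u, hu, hxu, huG⟩ :=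
            (isBasis_countableBasis χ).exists_subset_of_mem_open (hXG hx) hG
          exact Set.mem_biUnion (show u ∈ {u ∈ countableBasis χ | u ⊆ G} from ⟨hu, huG⟩) hxu)
      refine ⟨s, ⟨⟨hsf, fun u hu => (hs hu).1⟩, ?_⟩, by simpa [Set.sUnion_eq_biUnion] using hXs⟩
      exact (measure_mono (Set.sUnion_subset fun u hu => (hs hu).2)).trans_lt hGt
    · rintro ⟨s, ⟨-, hst⟩, hXs⟩
      exact (measure_mono hXs).trans_lt hst
  rw [h]
  exact MeasurableSet.biUnion hcount fun s hs => measurableSet_grainUnion_subset hZ <|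
    isOpen_sUnion fun u hu => isOpen_of_mem_countableBasis (hs.1.2 hu)

theorem measurable_multiscaleDensity {χ : Type*} [TopologicalSpace χ]
    [SecondCountableTopology χ] [MeasurableSpace χ] [OpensMeasurableSpace χ]
    (ν₁ ν₂ : Measure χ) [ν₁.OuterRegular] [ν₂.OuterRegular] {Z₁ Z₂ : χ → Compacts χ}
    (hZ₁ : MyopicallyContinuous Z₁) (hZ₂ : MyopicallyContinuous Z₂) (α lam γ₁ γ₂ : ℝ) :
    Measurable (multiscaleDensity α lam γ₁ γ₂ ν₁ ν₂ Z₁ Z₂) := by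
  have h₁ := (measurable_measure_grainUnion ν₁ hZ₁).ennreal_toReal
  have h₂ := (measurable_measure_grainUnion ν₂ hZ₂).ennreal_toReal
  have hcard : Measurable fun X : Configuration χ => lam ^ X.card :=
    (measurable_from_nat (f := fun n : ℕ => lam ^ n)).comp measurable_card
  exact ((measurable_const.mul hcard).mul (measurable_const.pow h₁.neg)).mul
    (measurable_const.pow h₂.neg)

/-- The number of points of a Poisson process of finite intensity has all exponential moments. -/
theorem integrable_pow_card {χ : Type*} [MeasurableSpace χ] (μ : Measure χ) [IsFiniteMeasure μ]
    {lam : ℝ} (hlam : 0 ≤ lam) :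
    Integrable (fun X : Configuration χ => lam ^ X.card) (poissonLaw μ) := by
  have hmeas : Measurable fun X : Configuration χ => lam ^ X.card :=
    (measurable_from_nat (f := fun n : ℕ => lam ^ n)).comp measurable_card
  refine ⟨hmeas.aestronglyMeasurable, ?_⟩
  rw [hasFiniteIntegral_iff_ofReal (Filter.Eventually.of_forall fun X => pow_nonneg hlam _),
    poissonLaw, lintegral_sum_measure]
  have hterm : ∀ n : ℕ, ∫⁻ X, ENNReal.ofReal (lam ^ Multiset.card X)
        ∂(ENNReal.ofReal (Real.exp (-μ.real Set.univ) / n.factorial) •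
          (Measure.pi fun _ : Fin n => μ).map (ofTuple n))
      = ENNReal.ofReal (Real.exp (-μ.real Set.univ) *
          ((lam * μ.real Set.univ) ^ n / n.factorial)) := by
    intro n
    rw [lintegral_smul_measure, lintegral_map hmeas.ennreal_ofReal (measurable_ofTuple n)]
    simp only [ofTuple, Multiset.card_map, Finset.card_val, Finset.card_univ, Fintype.card_fin,
      lintegral_const, Measure.pi_univ, Finset.prod_const, smul_eq_mul]
    rw [← ofReal_measureReal (μ := μ) (s := Set.univ), ← ENNReal.ofReal_pow measureReal_nonneg,
      ← ENNReal.ofReal_mul (by positivity), ← ENNReal.ofReal_mul (by positivity)]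
    congr 1
    ring
  simp_rw [hterm]
  rw [← ENNReal.ofReal_tsum_of_nonneg (fun n => by positivity)
    ((Real.summable_pow_div_factorial _).mul_left _)]
  exact ENNReal.ofReal_lt_top

theorem norm_multiscaleDensity_le {χ : Type*} [TopologicalSpace χ] [MeasurableSpace χ]
    (ν₁ ν₂ : Measure χ) [IsFiniteMeasure ν₂] (Z₁ Z₂ : χ → Compacts χ) {α lam γ₁ γ₂ : ℝ}
    (hα : 0 ≤ α) (hlam : 0 ≤ lam) (hγ₁ : 1 ≤ γ₁) (hγ₂ : 0 < γ₂) (hγ₂' : γ₂ ≤ 1)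
    (X : Configuration χ) :
    ‖multiscaleDensity α lam γ₁ γ₂ ν₁ ν₂ Z₁ Z₂ X‖
      ≤ α * γ₂ ^ (-ν₂.real Set.univ) * lam ^ X.card := by
  have h₁ : γ₁ ^ (-ν₁.real (grainUnion Z₁ X)) ≤ 1 :=
    Real.rpow_le_one_of_one_le_of_nonpos hγ₁ (neg_nonpos.2 measureReal_nonneg)
  have h₂ : γ₂ ^ (-ν₂.real (grainUnion Z₂ X)) ≤ γ₂ ^ (-ν₂.real Set.univ) :=
    Real.rpow_le_rpow_of_exponent_ge hγ₂ hγ₂' (neg_le_neg (measureReal_mono (Set.subset_univ _)))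
  have hγ₁' : 0 < γ₁ := one_pos.trans_le hγ₁
  rw [multiscaleDensity, Real.norm_of_nonneg (by positivity)]
  calc α * lam ^ X.card * γ₁ ^ (-ν₁.real (grainUnion Z₁ X)) * γ₂ ^ (-ν₂.real (grainUnion Z₂ X))
      ≤ α * lam ^ X.card * 1 * γ₂ ^ (-ν₂.real Set.univ) := by gcongr
    _ = α * γ₂ ^ (-ν₂.real Set.univ) * lam ^ X.card := by ring

end AreaInteraction

theorem theorem3 {χ : Type*} [TopologicalSpace χ] [T2Space χ] [SecondCountableTopology χ]
    [MeasurableSpace χ] [BorelSpace χ]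
    (μ : MeasureTheory.Measure χ) [MeasureTheory.IsFiniteMeasure μ]
    (ν₁ ν₂ : MeasureTheory.Measure χ)
    [MeasureTheory.IsFiniteMeasure ν₁] [MeasureTheory.IsFiniteMeasure ν₂]
    [ν₁.OuterRegular] [ν₂.OuterRegular]
    (Z₁ Z₂ : χ → TopologicalSpace.Compacts χ)
    (hZ₁ : AreaInteraction.MyopicallyContinuous Z₁)
    (hZ₂ : AreaInteraction.MyopicallyContinuous Z₂)
    (α lam γ₁ γ₂ : ℝ) (hα : 0 < α) (hlam : 0 < lam)
    (hγ₁ : 1 ≤ γ₁) (hγ₂ : 0 < γ₂) (hγ₂' : γ₂ ≤ 1) :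
    Measurable (AreaInteraction.multiscaleDensity α lam γ₁ γ₂ ν₁ ν₂ Z₁ Z₂) ∧
    MeasureTheory.Integrable (AreaInteraction.multiscaleDensity α lam γ₁ γ₂ ν₁ ν₂ Z₁ Z₂)
      (AreaInteraction.poissonLaw μ) := by
  have hmeas := AreaInteraction.measurable_multiscaleDensity ν₁ ν₂ hZ₁ hZ₂ α lam γ₁ γ₂
  exact ⟨hmeas, ((AreaInteraction.integrable_pow_card μ hlam.le).const_mul _).mono'
    hmeas.aestronglyMeasurable (Filter.Eventually.of_forall
      (AreaInteraction.norm_multiscaleDensity_le ν₁ ν₂ Z₁ Z₂ hα.le hlam.le hγ₁ hγ₂ hγ₂'))⟩
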